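/- Let $X$ be a compact complex manifold of dimension $n$ (not assumed connected) with $c_1^{BC}(X)=0$; that is, the Chern--Ricci form $\mathrm{Ric}(\omega)=-\sqrt{-1}\partial\bar\partial\log\det g$ of some (equivalently, any) Hermitian metric $\omega=\sqrt{-1}g_{i\bar j}dz^i\wedge d\overline{z^j}$ on $X$ equals $\sqrt{-1}\partial\bar\partial F$ for a smooth real function $F$. Let $\omega_0$ be a Hermitian metric on $X$, with matrix $g_0$, such that $\partial\bar\partial\omega_0^k=0$ for $k=1,2$. Then there is a smooth $F:X\to\mathbb R$ with $\mathrm{Ric}(\omega_0)=\sqrt{-1}\partial\bar\partial F$, and for every such $F$ the following holds. For a smooth function $\varphi:X\to\mathbb R$ with $\omega_\varphi=\omega_0+\sqrt{-1}\partial\bar\partial\varphi>0$, let $g_\varphi$ be the matrix of $\omega_\varphi$, let $\mathrm R_\varphi=(g_\varphi)^{i\bar j}R_{i\bar j}$ with $R_{i\bar j}=-\partial_i\partial_{\bar j}\log\det g_\varphi$ be its Chern scalar curvature, and let $(\mathrm{tr}\,T_\varphi)_j=T^p_{pj}$ be the trace of its torsion $T^k_{ij}=\Gamma^k_{ij}-\Gamma^k_{ji}$,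 where $\Gamma^k_{ij}=(g_\varphi)^{k\bar p}\partial_i (g_\varphi)_{j\bar p}$. The Chern--Calabi flow is the evolution equation $$\frac{\partial\varphi}{\partial t}=\mathrm R_\varphi+2\,\mathrm{Re}\Big\langle \mathrm{tr}\,T_\varphi,\ \partial\Big(\log\frac{\det g_\varphi}{\det g_0}-F\Big)\Big\rangle_\varphi,\qquad \langle a,b\rangle_\varphi=(g_\varphi)^{j\bar k}a_j\overline{b_k}.$$ Then, for every such $\varphi$, the metric $\omega_\varphi$ is a fixed point of the Chern--Calabi flow (that is, the family of potentials constant in time and equal to $\varphi$ solves the flow equation for all $t\ge 0$) if and only if $\omega_\varphi$ is Chern--Ricci-flat, i.e. $\mathrm{Ric}(\omega_\varphi)=0$. -/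

import Mathlib

open scoped Manifold ContDiff ComplexOrder

noncomputable section

namespace ChernCalabi

/-- The model space `ℂⁿ`. -/
abbrev Model (n : ℕ) : Type := EuclideanSpace ℂ (Fin n)

/-! ### Calculus in a holomorphic coordinate chart `z = (z¹, …, zⁿ)` -/

/-- The Wirtinger derivative `∂_i f = ∂f/∂zⁱ = ½ (∂f/∂xⁱ - √-1 ∂f/∂yⁱ)`. -/
def del {n : ℕ} (i : Fin n) (f : Model n → ℂ) (z : Model n) : ℂ :=
  (1 / 2 : ℂ) * (fderiv ℝ f z (EuclideanSpace.single i 1)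
    - Complex.I * fderiv ℝ f z (EuclideanSpace.single i Complex.I))

/-- The Wirtinger derivative `∂_{j̄} f = ∂f/∂z̄ʲ = ½ (∂f/∂xʲ + √-1 ∂f/∂yʲ)`. -/
def delBar {n : ℕ} (j : Fin n) (f : Model n → ℂ) (z : Model n) : ℂ :=
  (1 / 2 : ℂ) * (fderiv ℝ f z (EuclideanSpace.single j 1)
    + Complex.I * fderiv ℝ f z (EuclideanSpace.single j Complex.I))

/-- The coefficient `∂_i ∂_{j̄} f`; that is, `√-1∂∂̄f = √-1 (∂_i ∂_{j̄} f) dzⁱ ∧ dz̄ʲ`. -/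
def ddbar {n : ℕ} (f : Model n → ℝ) (i j : Fin n) (z : Model n) : ℂ :=
  del i (fun w => delBar j (fun v => (f v : ℂ)) w) z

/-! ### `(p,q)`-forms in a chart -/

/-- A `(p,q)`-form in a chart, through its coefficients `α_{I J̄}` (antisymmetric in `I` and in
`J`), for which `α = (1 / (p! q!)) ∑_{I,J} α_{I J̄} dz^I ∧ dz̄^J`. -/
abbrev LocalForm (n p q : ℕ) : Type := Model n → (Fin p → Fin n) → (Fin q → Fin n) → ℂ

/-- `∂ : Ω^{p,q} → Ω^{p+1,q}`. -/
def LocalForm.partialD {n p q : ℕ} (α : LocalForm n p q) : LocalForm n (p + 1) q :=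
  fun z I J => ∑ a : Fin (p + 1),
    (-1 : ℂ) ^ (a : ℕ) * del (I a) (fun w => α w (fun s => I (a.succAbove s)) J) z

/-- `∂̄ : Ω^{p,q} → Ω^{p,q+1}`; the sign `(-1)^p` comes from moving `dz̄ʲ` past `dz^I`. -/
def LocalForm.partialBarD {n p q : ℕ} (α : LocalForm n p q) : LocalForm n p (q + 1) :=
  fun z I J => (-1 : ℂ) ^ p * ∑ b : Fin (q + 1),
    (-1 : ℂ) ^ (b : ℕ) * delBar (J b) (fun w => α w I (fun s => J (b.succAbove s))) z

/-- The wedge product of a `(p,q)`-form with an `(r,s)`-form; the sign `(-1)^{qr}` comes from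
moving `dz̄^J` past `dz^K`. -/
def LocalForm.wedge {n p q r s : ℕ} (α : LocalForm n p q) (β : LocalForm n r s) :
    LocalForm n (p + r) (q + s) :=
  fun z M N => (-1 : ℂ) ^ (q * r) / (p.factorial * q.factorial * r.factorial * s.factorial : ℂ) *
    ∑ σ : Equiv.Perm (Fin (p + r)), ∑ τ : Equiv.Perm (Fin (q + s)),
      ((Equiv.Perm.sign σ : ℤ) : ℂ) * ((Equiv.Perm.sign τ : ℤ) : ℂ) *
        (α z (fun a => M (σ (Fin.castAdd r a))) (fun b => N (τ (Fin.castAdd s b))) *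
          β z (fun a => M (σ (Fin.natAdd p a))) (fun b => N (τ (Fin.natAdd q b))))

/-- The `k`-th exterior power of a `(1,1)`-form. -/
def LocalForm.wedgePow {n : ℕ} (α : LocalForm n 1 1) : (k : ℕ) → LocalForm n k k
  | 0 => fun _ _ _ => 1
  | k + 1 => (LocalForm.wedgePow α k).wedge α

/-! ### Chern geometry of a metric `G = (g_{i j̄})` in a chart -/

/-- The `(1,1)`-form `ω = √-1 g_{i j̄} dzⁱ ∧ dz̄ʲ`. -/
def fundForm {n : ℕ} (G : Model n → Matrix (Fin n) (Fin n) ℂ) : LocalForm n 1 1 :=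
  fun z I J => Complex.I * G z (I 0) (J 0)

/-- The inverse metric `g^{k p̄}`, normalised by `∑_p g^{k p̄} g_{i p̄} = δ_{ik}`. -/
def invMetric {n : ℕ} (G : Model n → Matrix (Fin n) (Fin n) ℂ) (k p : Fin n) (z : Model n) : ℂ :=
  (G z)⁻¹ p k

/-- The Christoffel symbols `Γ^k_{ij} = g^{k p̄} ∂_i g_{j p̄}` of the Chern connection. -/
def christoffel {n : ℕ} (G : Model n → Matrix (Fin n) (Fin n) ℂ) (k i j : Fin n)
    (z : Model n) : ℂ :=
  ∑ p, invMetric G k p z * del i (fun w => G w j p) z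

/-- The torsion `T^k_{ij} = Γ^k_{ij} - Γ^k_{ji}` of the Chern connection. -/
def torsion {n : ℕ} (G : Model n → Matrix (Fin n) (Fin n) ℂ) (k i j : Fin n) (z : Model n) : ℂ :=
  christoffel G k i j z - christoffel G k j i z

/-- The trace of the torsion, `(tr T)_j = T^p_{pj}`. -/
def trTorsion {n : ℕ} (G : Model n → Matrix (Fin n) (Fin n) ℂ) (j : Fin n) (z : Model n) : ℂ :=
  ∑ p, torsion G p p j z

/-- The Chern–Ricci curvature `R_{i j̄} = -∂_i ∂_{j̄} log det g`
(`det g` is a positive real number). -/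
def chernRicci {n : ℕ} (G : Model n → Matrix (Fin n) (Fin n) ℂ) (i j : Fin n) (z : Model n) : ℂ :=
  -ddbar (fun w => Real.log (G w).det.re) i j z

/-- The Chern scalar curvature `R = g^{i j̄} R_{i j̄}` (a real number). -/
def chernScalar {n : ℕ} (G : Model n → Matrix (Fin n) (Fin n) ℂ) (z : Model n) : ℝ :=
  (∑ i, ∑ j, invMetric G i j z * chernRicci G i j z).re

/-- The inner product `⟨a, b⟩_g = g^{j k̄} a_j \overline{b_k}` of `(1,0)`-forms. -/
def innerForms {n : ℕ} (G : Model n → Matrix (Fin n) (Fin n) ℂ) (a b : Fin n → Model n → ℂ)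
    (z : Model n) : ℂ :=
  ∑ j, ∑ k, invMetric G j k z * a j z * star (b k z)

/-- The right-hand side
`R(g) + 2 Re ⟨tr T(g), ∂ (log (det g / det g₀) - F)⟩_g` of the Chern–Calabi flow. -/
def flowRHS {n : ℕ} (G₀ : Model n → Matrix (Fin n) (Fin n) ℂ) (F : Model n → ℝ)
    (G : Model n → Matrix (Fin n) (Fin n) ℂ) (z : Model n) : ℝ :=
  chernScalar G z +
    2 * (innerForms G (trTorsion G)
      (fun k => del k fun w => ((Real.log ((G w).det.re / (G₀ w).det.re) - F w : ℝ) : ℂ)) z).re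

/-! ### Global objects on a complex manifold -/

/-- The Jacobian matrix `∂wᵃ/∂zⁱ` of the coordinate change from `e` (coordinates `z`) to `e'`
(coordinates `w`). -/
def jac {n : ℕ} {X : Type*} [TopologicalSpace X]
    (e e' : OpenPartialHomeomorph X (Model n)) (z : Model n) (a i : Fin n) : ℂ :=
  fderiv ℂ (fun v => e' (e.symm v)) z (EuclideanSpace.single i 1) a

/-- A smooth Hermitian metric on `X`: in every chart a smooth positive definite Hermitian matrix
`(g_{i j̄})`, transforming as a `(1,1)`-tensor. Only the values `coeff e z` for `e` in the atlas and
`z ∈ e.target` are meaningful. -/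
structure HermitianMetric (n : ℕ) (X : Type*) [TopologicalSpace X] [ChartedSpace (Model n) X] where
  coeff : OpenPartialHomeomorph X (Model n) → Model n → Matrix (Fin n) (Fin n) ℂ
  smooth : ∀ e ∈ atlas (Model n) X, ∀ i j,
    ContDiffOn ℝ ∞ (fun z => coeff e z i j) e.target
  posDef : ∀ e ∈ atlas (Model n) X, ∀ z ∈ e.target, (coeff e z).PosDef
  transform : ∀ e ∈ atlas (Model n) X, ∀ e' ∈ atlas (Model n) X, ∀ x ∈ e.source ∩ e'.source,
    ∀ i j, coeff e (e x) i j =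
      ∑ a, ∑ b, jac e e' (e x) a i * star (jac e e' (e x) b j) * coeff e' (e' x) a b

variable {n : ℕ} {X : Type*} [TopologicalSpace X] [ChartedSpace (Model n) X]

/-- `∂∂̄(ω^k) = 0` on `X`. -/
def HermitianMetric.DDbarPowEqZero (g : HermitianMetric n X) (k : ℕ) : Prop :=
  ∀ e ∈ atlas (Model n) X, ∀ z ∈ e.target, ∀ I J,
    ((fundForm (g.coeff e)).wedgePow k).partialBarD.partialD z I J = 0

/-- `Ric(ω) = 0`. -/
def HermitianMetric.ChernRicciFlat (g : HermitianMetric n X) : Prop :=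
  ∀ e ∈ atlas (Model n) X, ∀ z ∈ e.target, ∀ i j, chernRicci (g.coeff e) i j z = 0

variable (n) in
/-- Smooth real functions on the complex manifold `X` (as a real manifold). -/
def SmoothFun (f : X → ℝ) : Prop := ContMDiff 𝓘(ℝ, Model n) 𝓘(ℝ, ℝ) ∞ f

/-- `F` is a Chern–Ricci potential of `ω`: it is smooth and `Ric(ω) = √-1∂∂̄F`. -/
def HermitianMetric.IsChernRicciPotential (g : HermitianMetric n X) (F : X → ℝ) : Prop :=
  SmoothFun n F ∧ ∀ e ∈ atlas (Model n) X, ∀ z ∈ e.target, ∀ i j,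
    chernRicci (g.coeff e) i j z = ddbar (fun w => F (e.symm w)) i j z

variable (n X) in
/-- `c₁^{BC}(X) = 0`. The first Bott–Chern class is the class modulo `√-1∂∂̄C^∞(X,ℝ)` of the
Chern–Ricci form of a Hermitian metric on `X`, and does not depend on that metric; so it vanishes
iff the Chern–Ricci form of some metric is `√-1∂∂̄` of a smooth function. -/
def FirstBottChernClassEqZero : Prop :=
  ∃ (g : HermitianMetric n X) (F : X → ℝ), g.IsChernRicciPotential F

/-- `φ` is smooth and `g` is the metric of `ω_φ = ω₀ + √-1∂∂̄φ` (in particular `ω_φ > 0`). -/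
def HermitianMetric.IsDeformation (g₀ : HermitianMetric n X) (φ : X → ℝ)
    (g : HermitianMetric n X) : Prop :=
  SmoothFun n φ ∧ ∀ e ∈ atlas (Model n) X, ∀ z ∈ e.target, ∀ i j,
    g.coeff e z i j = g₀.coeff e z i j + ddbar (fun w => φ (e.symm w)) i j z

/-- The family of potentials `φ t` with metrics `ω_{φ t}`, for times `t ∈ S`, solves the
Chern–Calabi flow equation
`∂φ/∂t = R_φ + 2 Re ⟨tr T_φ, ∂ (log (det g_φ / det g₀) - F)⟩_φ`. -/
def HermitianMetric.SolvesChernCalabiFlow (g₀ : HermitianMetric n X) (F : X → ℝ) (S : Set ℝ)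
    (φ : ℝ → X → ℝ) (g : ℝ → HermitianMetric n X) : Prop :=
  ∀ t ∈ S, g₀.IsDeformation (φ t) (g t) ∧
    ∀ e ∈ atlas (Model n) X, ∀ z ∈ e.target,
      HasDerivWithinAt (fun s => φ s (e.symm z))
        (flowRHS (g₀.coeff e) (fun w => F (e.symm w)) ((g t).coeff e) z) S t

/-- `ω_φ` is a fixed point of the Chern–Calabi flow: it is a stationary solution. -/
def HermitianMetric.IsFixedPoint (g₀ : HermitianMetric n X) (F : X → ℝ)
    (φ : X → ℝ) (g : HermitianMetric n X) : Prop :=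
  g₀.SolvesChernCalabiFlow F (Set.Ici 0) (fun _ => φ) (fun _ => g)

end ChernCalabi

end

/-! Put u = log(det g_φ / det g₀) - F. Coordinate changes multiply both determinants by the same
|det J|², so u is a global smooth function, and Ric(ω₀) = √-1∂∂̄F gives Ric(ω_φ) = -√-1∂∂̄u. With Δu
= g^{i j̄}∂_i∂_{j̄}u, the right-hand side of the flow becomes -Δu + 2 Re⟨tr T, ∂u⟩: for the fixed
metric g_φ, a linear elliptic operator in u without zeroth-order term (`flowRHS_eq`).

If it vanishes, the strong maximum principle on each component of the compact X makes u locally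
constant, so Ric(ω_φ) = 0. Conversely Ric(ω_φ) = 0 gives Δu = 0, the same principle without drift
makes u locally constant, and both terms vanish. The torsion enters only as a continuous drift
coefficient.

The analytic core is `eventually_eq_of_isMaxOn`, Hopf's argument for an operator given by linear
functionals A and B on Hessians and gradients. Ellipticity is asked only as A ≤ 0 on negative
semidefinite forms and A > 0 on nonzero rank-one squares; `leviTrace_nonpos` and
`leviTrace_smulRight_pos` check this for the Chern Laplacian. -/

noncomputable section

open Filter Topology Set

namespace ChernCalabi

/-! ### Hopf's strong maximum principle -/

section MaximumPrinciple

variable {E : Type*} [NormedAddCommGroup E]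

theorem hasDerivAt_comp_line [NormedSpace ℝ E] {F : Type*} [NormedAddCommGroup F]
    [NormedSpace ℝ F] {f : E → F} {x w : E} {t : ℝ} (hf : DifferentiableAt ℝ f (x + t • w)) :
    HasDerivAt (fun s : ℝ => f (x + s • w)) (fderiv ℝ f (x + t • w) w) t := by
  have h1 : HasDerivAt (fun s : ℝ => x + s • w) w t := by
    simpa using ((hasDerivAt_id t).smul_const w).const_add x
  exact hf.hasFDerivAt.comp_hasDerivAt t h1

theorem ContDiffAt.differentiableAt_fderiv_of_two [NormedSpace ℝ E] {F : Type*}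
    [NormedAddCommGroup F] [NormedSpace ℝ F] {f : E → F} {x : E} (hf : ContDiffAt ℝ 2 f x) :
    DifferentiableAt ℝ (fderiv ℝ f) x :=
  (hf.fderiv_right (m := 1) (by norm_num)).differentiableAt (by norm_num)

theorem ContDiffAt.eventually_differentiableAt_of_two [NormedSpace ℝ E] {F : Type*}
    [NormedAddCommGroup F] [NormedSpace ℝ F] {f : E → F} {x : E} (hf : ContDiffAt ℝ 2 f x) :
    ∀ᶠ y in 𝓝 x, DifferentiableAt ℝ f y :=
  (hf.eventually (by norm_num)).mono fun _ h => h.differentiableAt (by norm_num)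

/-- The Hessian is negative semidefinite at a local maximum. -/
theorem fderiv_fderiv_apply_nonpos_of_isLocalMax [NormedSpace ℝ E] {f : E → ℝ} {x : E}
    (hf : ContDiffAt ℝ 2 f x) (hmax : IsLocalMax f x) (w : E) :
    fderiv ℝ (fderiv ℝ f) x w w ≤ 0 := by
  set γ : ℝ → ℝ := fun s => f (x + s • w) with hγ
  have hline : Tendsto (fun s : ℝ => x + s • w) (𝓝 0) (𝓝 x) := by
    have : Continuous fun s : ℝ => x + s • w := by fun_prop
    simpa using this.tendsto 0
  have h1 : deriv γ =ᶠ[𝓝 0] fun s => fderiv ℝ f (x + s • w) w := by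
    filter_upwards [hline.eventually (ContDiffAt.eventually_differentiableAt_of_two hf)] with s hs
    exact (hasDerivAt_comp_line hs).deriv
  have h2 : deriv (deriv γ) 0 = fderiv ℝ (fderiv ℝ f) x w w := by
    rw [h1.deriv_eq]
    have hd : DifferentiableAt ℝ (fderiv ℝ f) (x + (0 : ℝ) • w) := by
      simpa using ContDiffAt.differentiableAt_fderiv_of_two hf
    have := (hasDerivAt_comp_line hd).clm_apply (hasDerivAt_const (0 : ℝ) w)
    simpa using this.deriv
  have hγmax : IsLocalMax γ 0 := by
    have : ∀ᶠ s : ℝ in 𝓝 0, f (x + s • w) ≤ f x := hline.eventually hmax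
    simpa [IsLocalMax, IsMaxFilter, hγ] using this
  by_contra! hpos
  have hγcont : ContinuousAt γ 0 :=
    ContinuousAt.comp (g := f) (by simpa using hf.continuousAt) (by fun_prop)
  -- A positive second derivative would make 0 a local minimum as well, so `γ` would be locally
  -- constant and its second derivative zero.
  have hmin := isLocalMin_of_deriv_deriv_pos (f := γ) (x₀ := 0) (by rw [h2]; exact hpos)
    hγmax.deriv_eq_zero hγcont
  have hconst : γ =ᶠ[𝓝 0] fun _ => γ 0 := by
    filter_upwards [hγmax, hmin] with s h h' using le_antisymm h h'
  have : deriv (deriv γ) 0 = 0 := by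
    rw [hconst.deriv.deriv_eq]
    simp
  rw [← h2, this] at hpos
  exact lt_irrefl _ hpos

variable [InnerProductSpace ℝ E]

variable (E) in
/-- The real inner product as a continuous bilinear map. -/
def realInnerL : E →L[ℝ] E →L[ℝ] ℝ :=
  (innerₗ E).mkContinuous₂ 1 fun x y => by simpa using norm_inner_le_norm (𝕜 := ℝ) x y

@[simp]
theorem realInnerL_apply (x y : E) : realInnerL E x y = inner ℝ x y := rfl

/-- The barrier of Hopf's lemma. -/
def barrier (q : E) (α : ℝ) (x : E) : ℝ := Real.exp (-α * ‖x - q‖ ^ 2)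

theorem contDiff_barrier (q : E) (α : ℝ) {k : ℕ∞ω} : ContDiff ℝ k (barrier q α) := by
  unfold barrier
  exact (contDiff_const.mul ((contDiff_id.sub contDiff_const).norm_sq ℝ)).exp

theorem fderiv_barrier (q : E) (α : ℝ) :
    fderiv ℝ (barrier q α) = fun x => (-(2 * α) * barrier q α x) • realInnerL E (x - q) := by
  funext x
  have h1 : HasFDerivAt (fun y : E => ‖y - q‖ ^ 2) (2 • realInnerL E (x - q)) x := by
    refine ((hasFDerivAt_id x).sub_const q).norm_sq.congr_fderiv ?_
    ext v
    simp
  have h2 := (h1.const_mul (-α)).exp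
  rw [show barrier q α = fun y => Real.exp (-α * ‖y - q‖ ^ 2) from rfl, h2.fderiv]
  ext v
  simp
  ring

/-- The rank-one term carries α² and the other term only α, so for large α ellipticity in the
direction `x - q` decides the sign. -/
theorem fderiv_fderiv_barrier (q : E) (α : ℝ) (x : E) :
    fderiv ℝ (fderiv ℝ (barrier q α)) x =
      barrier q α x • ((4 * α ^ 2) • (realInnerL E (x - q)).smulRight (realInnerL E (x - q))
        + (-(2 * α)) • realInnerL E) := by
  rw [fderiv_barrier]
  have hb : HasFDerivAt (barrier q α) ((-(2 * α) * barrier q α x) • realInnerL E (x - q)) x := by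
    rw [← congrFun (fderiv_barrier q α) x]
    exact ((contDiff_barrier q α (k := 1)).differentiable (by norm_num) x).hasFDerivAt
  have hi : HasFDerivAt (fun y : E => realInnerL E (y - q)) (realInnerL E) x := by
    have := (realInnerL E).hasFDerivAt (x := x - q)
    exact this.comp x ((hasFDerivAt_id x).sub_const q)
  have := ((hb.const_mul (-(2 * α))).smul hi).fderiv
  refine this.trans ?_
  ext v w
  simp
  ring

/-- Hopf's strong maximum principle: the set where a subsolution of a linear elliptic equation
attains its maximum is open. -/
theorem eventually_eq_of_isMaxOn [ProperSpace E] {U : Set E} (hU : IsOpen U)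
    (A : E → (E →L[ℝ] E →L[ℝ] ℝ) →ₗ[ℝ] ℝ) (B : E → (E →L[ℝ] ℝ) →ₗ[ℝ] ℝ)
    (hAcont : ∀ S : E → E →L[ℝ] E →L[ℝ] ℝ, Continuous S → ContinuousOn (fun z => A z (S z)) U)
    (hBcont : ∀ l : E → E →L[ℝ] ℝ, Continuous l → ContinuousOn (fun z => B z (l z)) U)
    (hAneg : ∀ z ∈ U, ∀ S : E →L[ℝ] E →L[ℝ] ℝ, (∀ v, S v v ≤ 0) → A z S ≤ 0)
    (hApos : ∀ z ∈ U, ∀ l : E →L[ℝ] ℝ, l ≠ 0 → 0 < A z (l.smulRight l))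
    {u : E → ℝ} (hu : ContDiffOn ℝ 2 u U)
    (hLu : ∀ z ∈ U, 0 ≤ A z (fderiv ℝ (fderiv ℝ u) z) + B z (fderiv ℝ u z))
    {p : E} (hp : p ∈ U) (hmax : ∀ z ∈ U, u z ≤ u p) :
    ∀ᶠ z in 𝓝 p, u z = u p := by
  -- The radius 2r leaves room: `q` will lie within r of `p` and its nearest maximum point `x₀`
  -- within r of `q`, so the open ball about `q` through `x₀` stays inside.
  obtain ⟨r, hr, hrU⟩ : ∃ r > 0, Metric.closedBall p (2 * r) ⊆ U := by
    obtain ⟨r, hr, h⟩ := Metric.nhds_basis_closedBall.mem_iff.1 (hU.mem_nhds hp)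
    exact ⟨r / 2, by positivity, by convert h using 2; ring⟩
  by_contra hne
  obtain ⟨q, hqr, hq⟩ : ∃ q, dist q p < r ∧ u q ≠ u p := by
    by_contra! h
    exact hne (Metric.eventually_nhds_iff.2 ⟨r, hr, fun y hy => h y hy⟩)
  have hcont : ContinuousOn u (Metric.closedBall p (2 * r)) := hu.continuousOn.mono hrU
  set K := Metric.closedBall p (2 * r) ∩ u ⁻¹' {u p} with hK
  have hKc : IsCompact K := (isCompact_closedBall p (2 * r)).of_isClosed_subset
    (hcont.preimage_isClosed_of_isClosed Metric.isClosed_closedBall isClosed_singleton)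
    inter_subset_left
  have hpK : p ∈ K := ⟨Metric.mem_closedBall_self (by positivity), rfl⟩
  obtain ⟨x₀, hx₀K, hx₀⟩ := hKc.exists_infDist_eq_dist ⟨p, hpK⟩ q
  have hdle : dist q x₀ < r := by
    rw [← hx₀]; exact (Metric.infDist_le_dist_of_mem hpK).trans_lt hqr
  have hlt : ∀ y, dist q y < dist q x₀ → u y < u p := by
    intro y hy
    have hyb : y ∈ Metric.closedBall p (2 * r) := by
      rw [Metric.mem_closedBall]
      have := dist_triangle_left y p q
      linarith
    refine lt_of_le_of_ne (hmax y (hrU hyb)) fun h => ?_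
    have := Metric.infDist_le_dist_of_mem (x := q) (show y ∈ K from ⟨hyb, h⟩)
    linarith
  have hux₀ : u x₀ = u p := hx₀K.2
  have hx₀U : x₀ ∈ U := hrU hx₀K.1
  have hqx : q ≠ x₀ := fun h => hq (h ▸ hux₀)
  -- Halving the ball about `q` gives one internally tangent to it at `x₀`: its closure meets the
  -- maximum set only at `x₀`. The strict inclusion away from `x₀` comes from the parallelogram law.
  set q' := midpoint ℝ q x₀ with hq'
  set d := dist x₀ q' with hd
  have hxq' : x₀ - q' ≠ 0 := by
    rw [sub_ne_zero]
    intro h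
    exact hqx ((midpoint_eq_right_iff ℝ).1 h.symm)
  have hball : ∀ y, dist y q' ≤ d → y ≠ x₀ → u y < u p := by
    intro y hy hne
    refine hlt y ?_
    have hm : q' - q = x₀ - q' := by
      rw [hq', midpoint_sub_left, right_sub_midpoint]
    have h1 : y - q = (y - q') + (x₀ - q') := by rw [← hm]; abel
    have h2 : x₀ - q = (x₀ - q') + (x₀ - q') := by nth_rw 1 [← hm]; abel
    have h3 : 0 < ‖(y - q') - (x₀ - q')‖ := by
      rw [norm_pos_iff]; simpa [sub_eq_zero] using hne
    have h4 := parallelogram_law_with_norm ℝ (y - q') (x₀ - q')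
    rw [hd, dist_eq_norm, dist_eq_norm] at hy
    rw [dist_comm, dist_comm q, dist_eq_norm, dist_eq_norm, h2, ← two_smul ℝ (x₀ - q'), norm_smul,
      h1]
    have := norm_nonneg (y - q')
    refine lt_of_pow_lt_pow_left₀ 2 (by positivity) ?_
    simp only [Real.norm_ofNat]
    nlinarith
  -- the barrier is a strict subsolution near `x₀`
  obtain ⟨α, hα, hLpos⟩ : ∃ α > 0, ∀ᶠ z in 𝓝 x₀,
      0 < A z (fderiv ℝ (fderiv ℝ (barrier q' α)) z) + B z (fderiv ℝ (barrier q' α) z) := by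
    set a := A x₀ ((realInnerL E (x₀ - q')).smulRight (realInnerL E (x₀ - q'))) with ha
    set b := A x₀ (realInnerL E) + B x₀ (realInnerL E (x₀ - q')) with hb
    have hapos : 0 < a := hApos x₀ hx₀U _ fun h => hxq' (by
      have := congrArg (fun l => l (x₀ - q')) h
      exact inner_self_eq_zero.1 this)
    -- At `x₀` the operator sends the barrier to barrier · 2α(2αa - b), and this α makes αa = |b| +
    -- 1 exceed b.
    refine ⟨(|b| + 1) / a, by positivity, ?_⟩
    set α := (|b| + 1) / a with hα
    have hαpos : 0 < α := by positivity
    have hαa : α * a = |b| + 1 := by rw [hα]; field_simp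
    have hsm := contDiff_barrier (E := E) q' α (k := ∞)
    have hc : ContinuousAt (fun z => A z (fderiv ℝ (fderiv ℝ (barrier q' α)) z)
        + B z (fderiv ℝ (barrier q' α) z)) x₀ :=
      ((hAcont _ ((hsm.fderiv_right (m := ∞) (by simp)).continuous_fderiv (by simp))).continuousAt
        (hU.mem_nhds hx₀U)).add
        ((hBcont _ (hsm.continuous_fderiv (by simp))).continuousAt (hU.mem_nhds hx₀U))
    refine hc.eventually (lt_mem_nhds ?_)
    beta_reduce
    rw [fderiv_fderiv_barrier, fderiv_barrier]
    rw [(A x₀).map_smul, (A x₀).map_add, (A x₀).map_smul, (A x₀).map_smul, (B x₀).map_smul, ← ha]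
    simp only [smul_eq_mul]
    have hbar : 0 < barrier q' α x₀ := Real.exp_pos _
    have : 0 < barrier q' α x₀ * (2 * α * (2 * (α * a) - b)) := by
      have := le_abs_self b
      have := abs_nonneg b
      have : 0 < 2 * (α * a) - b := by rw [hαa]; linarith
      positivity
    refine this.trans_eq ?_
    rw [hb]; ring
  obtain ⟨ρ, hρ, hρU⟩ := Metric.nhds_basis_closedBall.mem_iff.1
    (Filter.inter_mem (hU.mem_nhds hx₀U) hLpos)
  have hucont : ContinuousOn u (Metric.closedBall x₀ ρ) :=
    hu.continuousOn.mono fun z hz => (hρU hz).1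
  have hbarcont : Continuous (barrier q' α) := (contDiff_barrier q' α (k := 0)).continuous
  -- On the part of the sphere inside the tangent ball, compactness gives a uniform gap below the
  -- maximum; if that part is empty, any ε serves.
  obtain ⟨ε, hε, hεu⟩ : ∃ ε > 0, ∀ y ∈ Metric.sphere x₀ ρ ∩ Metric.closedBall q' d,
      u y ≤ u p - ε := by
    rcases (Metric.sphere x₀ ρ ∩ Metric.closedBall q' d).eq_empty_or_nonempty with h | h
    · exact ⟨1, one_pos, by simp [h]⟩
    · obtain ⟨y, hy, hymax⟩ := ((isCompact_sphere x₀ ρ).inter_right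
        Metric.isClosed_closedBall).exists_isMaxOn h
        (hucont.mono (inter_subset_left.trans Metric.sphere_subset_closedBall))
      refine ⟨u p - u y, sub_pos.2 (hball y hy.2 ?_), fun z hz => by simpa using hymax hz⟩
      rintro rfl
      exact hρ.ne (by simpa using hy.1)
  set v : E → ℝ := fun y => u y + ε * barrier q' α y with hv
  obtain ⟨z, hz, hzmax⟩ := (isCompact_closedBall x₀ ρ).exists_isMaxOn
    ⟨x₀, Metric.mem_closedBall_self hρ.le⟩
    (show ContinuousOn v (Metric.closedBall x₀ ρ) from
      hucont.add (hbarcont.const_smul ε).continuousOn)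
  have hvx₀ : v x₀ = u p + ε * barrier q' α x₀ := by rw [hv, ← hux₀]
  -- The perturbed function stays below its value at `x₀` on the whole sphere: inside the tangent
  -- ball the gap ε absorbs the barrier, which is at most 1; outside, the barrier is smaller than at
  -- `x₀`.
  have hzball : z ∈ Metric.ball x₀ ρ := by
    refine lt_of_le_of_ne (Metric.mem_closedBall.1 hz) fun hzs => ?_
    have hle : v x₀ ≤ v z := hzmax (Metric.mem_closedBall_self hρ.le)
    rw [hvx₀] at hle
    by_cases hzd : dist z q' ≤ d
    · have h1 := hεu z ⟨hzs, hzd⟩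
      have h2 : barrier q' α z ≤ 1 := Real.exp_le_one_iff.2 (by
        have : 0 ≤ α * ‖z - q'‖ ^ 2 := by positivity
        linarith)
      have h3 : 0 < barrier q' α x₀ := Real.exp_pos _
      simp only [hv] at hle
      nlinarith
    · have h1 := hmax z (hρU hz).1
      have h2 : barrier q' α z < barrier q' α x₀ := by
        refine Real.exp_lt_exp.2 ?_
        rw [hd, dist_eq_norm, dist_eq_norm, not_le] at hzd
        have : ‖x₀ - q'‖ ^ 2 < ‖z - q'‖ ^ 2 := by gcongr
        nlinarith
      simp only [hv] at hle
      nlinarith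
  have hzU := (hρU hz).1
  have huz : ContDiffAt ℝ 2 u z := hu.contDiffAt (hU.mem_nhds hzU)
  have hbz : ContDiffAt ℝ 2 (barrier q' α) z := (contDiff_barrier q' α).contDiffAt
  have hvz : ContDiffAt ℝ 2 v z := huz.add (contDiffAt_const.mul hbz)
  have hlocmax : IsLocalMax v z := hzmax.isLocalMax
    (mem_of_superset (Metric.isOpen_ball.mem_nhds hzball) Metric.ball_subset_closedBall)
  have hdv : fderiv ℝ v =ᶠ[𝓝 z] fun y => fderiv ℝ u y + ε • fderiv ℝ (barrier q' α) y := by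
    filter_upwards [ContDiffAt.eventually_differentiableAt_of_two huz,
      ContDiffAt.eventually_differentiableAt_of_two hbz] with y h1 h2
    exact (h1.hasFDerivAt.add (h2.hasFDerivAt.const_mul ε)).fderiv
  have hddv : fderiv ℝ (fderiv ℝ v) z =
      fderiv ℝ (fderiv ℝ u) z + ε • fderiv ℝ (fderiv ℝ (barrier q' α)) z := by
    rw [hdv.fderiv_eq]
    exact ((ContDiffAt.differentiableAt_fderiv_of_two huz).hasFDerivAt.add
      ((ContDiffAt.differentiableAt_fderiv_of_two hbz).hasFDerivAt.const_smul ε)).fderiv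
  -- At the interior maximum of `v` the operator is nonpositive, yet it is nonnegative on `u` and
  -- positive on the barrier.
  have h1 := hAneg z hzU _ (fderiv_fderiv_apply_nonpos_of_isLocalMax hvz hlocmax)
  have h2 : B z (fderiv ℝ v z) = 0 := by rw [hlocmax.fderiv_eq_zero, map_zero]
  rw [hdv.eq_of_nhds] at h2
  rw [hddv] at h1
  simp only [map_add, map_smul, smul_eq_mul] at h1 h2
  have h3 := hLu z hzU
  have h4 : 0 < A z (fderiv ℝ (fderiv ℝ (barrier q' α)) z) + B z (fderiv ℝ (barrier q' α) z) :=
    (hρU hz).2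
  nlinarith

end MaximumPrinciple

/-! ### Wirtinger derivatives as parts of real derivatives; ellipticity of the Levi trace -/

section ChartCalculus

variable {n : ℕ}

/-- The `(1,0)`-part `ξ ↦ ½ (l ξ - √-1 l (√-1 ξ))` of a real covector. -/
def covectorOneZero (l : Model n →L[ℝ] ℝ) (ξ : Model n) : ℂ :=
  (1 / 2 : ℂ) * ((l ξ : ℂ) - Complex.I * (l (Complex.I • ξ) : ℂ))

/-- The Levi form of a real bilinear form. -/
def leviForm (S : Model n →L[ℝ] Model n →L[ℝ] ℝ) (ξ η : Model n) : ℂ :=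
  (1 / 4 : ℂ) * ((S ξ η + S (Complex.I • ξ) (Complex.I • η) : ℝ)
    + Complex.I * (S ξ (Complex.I • η) - S (Complex.I • ξ) η : ℝ))

theorem single_I (i : Fin n) : (EuclideanSpace.single i Complex.I : Model n) =
    Complex.I • EuclideanSpace.single i (1 : ℂ) := by
  ext j
  by_cases h : j = i <;> simp [h]

theorem I_smul_I_smul (ξ : Model n) : Complex.I • Complex.I • ξ = -ξ := by
  rw [smul_smul, Complex.I_mul_I, neg_one_smul]

theorem complex_smul_eq (c : ℂ) (ξ : Model n) : c • ξ = c.re • ξ + c.im • Complex.I • ξ := by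
  nth_rw 1 [← Complex.re_add_im c, add_smul, mul_smul]
  simp

theorem covectorOneZero_add (l : Model n →L[ℝ] ℝ) (ξ η : Model n) :
    covectorOneZero l (ξ + η) = covectorOneZero l ξ + covectorOneZero l η := by
  simp only [covectorOneZero, smul_add, map_add, Complex.ofReal_add]
  ring

theorem covectorOneZero_smul (l : Model n →L[ℝ] ℝ) (c : ℂ) (ξ : Model n) :
    covectorOneZero l (c • ξ) = c * covectorOneZero l ξ := by
  have h : Complex.I • c • ξ = c.re • Complex.I • ξ - c.im • ξ := by
    rw [complex_smul_eq c, smul_add, smul_comm Complex.I c.re, smul_comm Complex.I c.im,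
      I_smul_I_smul, smul_neg, sub_eq_add_neg]
  simp only [covectorOneZero]
  rw [h, complex_smul_eq c ξ]
  simp only [map_add, map_sub, map_smul, smul_eq_mul, Complex.ofReal_add, Complex.ofReal_sub,
    Complex.ofReal_mul]
  conv_rhs => rw [← Complex.re_add_im c]
  linear_combination ((1 / 2 : ℂ) * c.im * l (Complex.I • ξ)) * Complex.I_mul_I

theorem sum_smul_single (ξ : Model n) :
    ∑ i, ξ i • (EuclideanSpace.single i (1 : ℂ) : Model n) = ξ := by
  ext j
  simp [Finset.sum_apply, Pi.single_apply]

theorem covectorOneZero_eq_sum (l : Model n →L[ℝ] ℝ) (ξ : Model n) :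
    covectorOneZero l ξ = ∑ i, ξ i * covectorOneZero l (EuclideanSpace.single i 1) := by
  let f : Model n →ₗ[ℂ] ℂ :=
    { toFun := covectorOneZero l
      map_add' := covectorOneZero_add l
      map_smul' := fun c ξ => by simp [covectorOneZero_smul] }
  have : f (∑ i, ξ i • (EuclideanSpace.single i (1 : ℂ) : Model n)) = f ξ := by
    rw [sum_smul_single]
  rw [map_sum] at this
  simpa [f, covectorOneZero_smul] using this.symm

/-- A real covector is recovered from its (1,0)-part, so a nonzero one has a nonzero (1,0)-part. -/
theorem covectorOneZero_re (l : Model n →L[ℝ] ℝ) (ξ : Model n) :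
    (covectorOneZero l ξ).re = l ξ / 2 := by
  simp [covectorOneZero]
  ring

/-- With one slot fixed, the Levi form is a combination of (1,0)-parts in ξ, and of their conjugates
in η; hence it is sesquilinear and determined on the basis. -/
theorem leviForm_eq_sum (S : Model n →L[ℝ] Model n →L[ℝ] ℝ) (ξ η : Model n) :
    leviForm S ξ η = ∑ i, ∑ j, ξ i * star (η j) *
      leviForm S (EuclideanSpace.single i 1) (EuclideanSpace.single j 1) := by
  have h1 : ∀ ξ η, leviForm S ξ η =
      (1 / 2 : ℂ) * (covectorOneZero (S.flip η) ξ
        + Complex.I * covectorOneZero (S.flip (Complex.I • η)) ξ) := by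
    intro ξ η
    simp only [leviForm, covectorOneZero, ContinuousLinearMap.flip_apply]
    push_cast
    linear_combination ((1 / 4 : ℂ) * S (Complex.I • ξ) (Complex.I • η)) * Complex.I_mul_I
  have h2 : ∀ ξ η, leviForm S ξ η =
      (1 / 2 : ℂ) * (star (covectorOneZero (S ξ) η)
        - Complex.I * star (covectorOneZero (S (Complex.I • ξ)) η)) := by
    intro ξ η
    simp only [leviForm, covectorOneZero]
    simp
    linear_combination ((1 / 4 : ℂ) * S (Complex.I • ξ) (Complex.I • η)) * Complex.I_mul_I
  have h3 : ∀ ξ η, leviForm S ξ η =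
      ∑ i, ξ i * leviForm S (EuclideanSpace.single i 1) η := by
    intro ξ η
    simp only [h1]
    rw [covectorOneZero_eq_sum, covectorOneZero_eq_sum (S.flip (Complex.I • η)), Finset.mul_sum,
      ← Finset.sum_add_distrib, Finset.mul_sum]
    exact Finset.sum_congr rfl fun i _ => by ring
  have h4 : ∀ ξ η, leviForm S ξ η =
      ∑ j, star (η j) * leviForm S ξ (EuclideanSpace.single j 1) := by
    intro ξ η
    simp only [h2]
    rw [covectorOneZero_eq_sum, covectorOneZero_eq_sum (S (Complex.I • ξ)), star_sum, star_sum,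
      Finset.mul_sum, ← Finset.sum_sub_distrib, Finset.mul_sum]
    exact Finset.sum_congr rfl fun i _ => by simp only [star_mul']; ring
  rw [h3]
  refine Finset.sum_congr rfl fun i _ => ?_
  rw [h4, Finset.mul_sum]
  exact Finset.sum_congr rfl fun j _ => by ring

theorem leviForm_self_re (S : Model n →L[ℝ] Model n →L[ℝ] ℝ) (ξ : Model n) :
    (leviForm S ξ ξ).re = (S ξ ξ + S (Complex.I • ξ) (Complex.I • ξ)) / 4 := by
  simp [leviForm]
  ring

theorem leviForm_smulRight (l : Model n →L[ℝ] ℝ) (ξ η : Model n) :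
    leviForm (l.smulRight l) ξ η = covectorOneZero l ξ * star (covectorOneZero l η) := by
  simp only [leviForm, covectorOneZero]
  simp
  linear_combination ((1 / 4 : ℂ) * l (Complex.I • ξ) * l (Complex.I • η)) * Complex.I_mul_I

theorem covectorOneZero_add_left (l l' : Model n →L[ℝ] ℝ) (ξ : Model n) :
    covectorOneZero (l + l') ξ = covectorOneZero l ξ + covectorOneZero l' ξ := by
  simp only [covectorOneZero, add_apply, Complex.ofReal_add]
  ring

theorem covectorOneZero_smul_left (c : ℝ) (l : Model n →L[ℝ] ℝ) (ξ : Model n) :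
    covectorOneZero (c • l) ξ = c * covectorOneZero l ξ := by
  simp only [covectorOneZero, smul_apply, smul_eq_mul, Complex.ofReal_mul]
  ring

theorem leviForm_add_left (S S' : Model n →L[ℝ] Model n →L[ℝ] ℝ) (ξ η : Model n) :
    leviForm (S + S') ξ η = leviForm S ξ η + leviForm S' ξ η := by
  simp only [leviForm, add_apply]
  push_cast
  ring

theorem leviForm_smul_left (c : ℝ) (S : Model n →L[ℝ] Model n →L[ℝ] ℝ) (ξ η : Model n) :
    leviForm (c • S) ξ η = c * leviForm S ξ η := by
  simp only [leviForm, smul_apply, smul_eq_mul]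
  push_cast
  ring

/-- The trace `Re ∑ M_{ji} S_{i j̄}` of the Levi form of `S`. -/
def leviTrace (M : Matrix (Fin n) (Fin n) ℂ) : (Model n →L[ℝ] Model n →L[ℝ] ℝ) →ₗ[ℝ] ℝ where
  toFun S := (∑ i, ∑ j, M j i *
    leviForm S (EuclideanSpace.single i 1) (EuclideanSpace.single j 1)).re
  map_add' S S' := by
    rw [← Complex.add_re]
    simp only [← Finset.sum_add_distrib, ← mul_add, ← leviForm_add_left]
  map_smul' c S := by
    simp only [RingHom.id_apply, smul_eq_mul, leviForm_smul_left, mul_left_comm _ (c : ℂ),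
      ← Finset.mul_sum, Complex.re_ofReal_mul]

theorem leviTrace_apply (M : Matrix (Fin n) (Fin n) ℂ) (S : Model n →L[ℝ] Model n →L[ℝ] ℝ) :
    leviTrace M S = (∑ i, ∑ j, M j i *
      leviForm S (EuclideanSpace.single i 1) (EuclideanSpace.single j 1)).re := rfl

open scoped MatrixOrder in
-- Writing M = B*B turns the trace into a sum of Levi forms on the rows of B, each with real part
-- (S(ξ,ξ) + S(√-1ξ,√-1ξ))/4.
theorem leviTrace_nonpos {M : Matrix (Fin n) (Fin n) ℂ} (hM : M.PosSemidef)
    {S : Model n →L[ℝ] Model n →L[ℝ] ℝ} (hS : ∀ v, S v v ≤ 0) : leviTrace M S ≤ 0 := by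
  obtain ⟨B, rfl⟩ := CStarAlgebra.nonneg_iff_eq_star_mul_self.mp hM.nonneg
  have h : ∑ i, ∑ j, (star B * B) j i *
      leviForm S (EuclideanSpace.single i 1) (EuclideanSpace.single j 1) =
      ∑ k, leviForm S (WithLp.toLp 2 (B k)) (WithLp.toLp 2 (B k)) := by
    rw [Finset.sum_congr rfl fun k _ => leviForm_eq_sum S (WithLp.toLp 2 (B k)) _,
      Finset.sum_comm (s := Finset.univ (α := Fin n))
        (f := fun k i => ∑ j, WithLp.toLp 2 (B k) i * star (WithLp.toLp 2 (B k) j) *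
          leviForm S (EuclideanSpace.single i 1) (EuclideanSpace.single j 1))]
    refine Finset.sum_congr rfl fun i _ => ?_
    rw [Finset.sum_comm]
    refine Finset.sum_congr rfl fun j _ => ?_
    rw [Matrix.mul_apply, Finset.sum_mul]
    refine Finset.sum_congr rfl fun k _ => ?_
    simp [Matrix.star_apply, mul_comm]
  rw [leviTrace_apply, h, Complex.re_sum]
  refine Finset.sum_nonpos fun k _ => ?_
  rw [leviForm_self_re]
  have h1 := hS (WithLp.toLp 2 (B k))
  have h2 := hS (Complex.I • WithLp.toLp 2 (B k))
  linarith

/-- On a rank-one square the trace is the Hermitian form of M at the coefficient vector of the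
(1,0)-part of `l`. -/
theorem leviTrace_smulRight_pos {M : Matrix (Fin n) (Fin n) ℂ} (hM : M.PosDef)
    {l : Model n →L[ℝ] ℝ} (hl : l ≠ 0) : 0 < leviTrace M (l.smulRight l) := by
  set c : Fin n → ℂ := fun i => covectorOneZero l (EuclideanSpace.single i 1) with hc
  have hc0 : c ≠ 0 := by
    refine fun h => hl (ContinuousLinearMap.ext fun ξ => ?_)
    have h1 := covectorOneZero_re l ξ
    rw [covectorOneZero_eq_sum, Finset.sum_eq_zero fun i _ => by
      rw [show covectorOneZero l (EuclideanSpace.single i 1) = 0 from congrFun h i, mul_zero]] at h1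
    simp only [Complex.zero_re] at h1
    simp only [zero_apply]
    linarith
  have h := (Complex.pos_iff.1 (hM.dotProduct_mulVec_pos hc0)).1
  convert h using 1
  rw [leviTrace_apply, Finset.sum_comm]
  congr 1
  simp only [dotProduct, Matrix.mulVec, Finset.mul_sum]
  refine Finset.sum_congr rfl fun j _ => Finset.sum_congr rfl fun i _ => ?_
  rw [leviForm_smulRight]
  simp [hc]
  ring

/-- The pairing `Re ∑ M_{kj} a_j \overline{l_k}` of `a` with the `(1,0)`-part of `l`. -/
def covectorPairing (M : Matrix (Fin n) (Fin n) ℂ) (a : Fin n → ℂ) :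
    (Model n →L[ℝ] ℝ) →ₗ[ℝ] ℝ where
  toFun l := (∑ j, ∑ k, M k j * a j * star (covectorOneZero l (EuclideanSpace.single k 1))).re
  map_add' l l' := by
    rw [← Complex.add_re]
    simp only [← Finset.sum_add_distrib, ← mul_add, covectorOneZero_add_left, star_add]
  map_smul' c l := by
    simp only [RingHom.id_apply, smul_eq_mul, covectorOneZero_smul_left, star_mul',
      Complex.star_def, Complex.conj_ofReal, mul_left_comm _ (c : ℂ), ← Finset.mul_sum,
      Complex.re_ofReal_mul]

theorem covectorPairing_apply (M : Matrix (Fin n) (Fin n) ℂ) (a : Fin n → ℂ)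
    (l : Model n →L[ℝ] ℝ) : covectorPairing M a l =
      (∑ j, ∑ k, M k j * a j * star (covectorOneZero l (EuclideanSpace.single k 1))).re := rfl

theorem del_eq_covectorOneZero {f : Model n → ℝ} {z : Model n} (hf : DifferentiableAt ℝ f z)
    (i : Fin n) : del i (fun w => (f w : ℂ)) z =
      covectorOneZero (fderiv ℝ f z) (EuclideanSpace.single i 1) := by
  have h : fderiv ℝ (fun w => (f w : ℂ)) z = Complex.ofRealCLM.comp (fderiv ℝ f z) :=
    (Complex.ofRealCLM.hasFDerivAt.comp z hf.hasFDerivAt).fderiv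
  simp only [del, h, covectorOneZero, single_I]
  simp

/-- The first slot of `leviForm` is the outer derivative, so the formula needs no symmetry of the
Hessian. -/
theorem ddbar_eq_leviForm {f : Model n → ℝ} {z : Model n} (hf : ContDiffAt ℝ 2 f z)
    (i j : Fin n) : ddbar f i j z =
      leviForm (fderiv ℝ (fderiv ℝ f) z) (EuclideanSpace.single i 1)
        (EuclideanSpace.single j 1) := by
  set e : Model n := EuclideanSpace.single j (1 : ℂ) with he
  set S := fderiv ℝ (fderiv ℝ f) z with hS
  have h1 : (fun w => delBar j (fun v => (f v : ℂ)) w) =ᶠ[𝓝 z] fun w =>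
      (1 / 2 : ℂ) * ((fderiv ℝ f w e : ℂ) + Complex.I * (fderiv ℝ f w (Complex.I • e) : ℂ)) := by
    filter_upwards [ContDiffAt.eventually_differentiableAt_of_two hf] with w hw
    have h : fderiv ℝ (fun w => (f w : ℂ)) w = Complex.ofRealCLM.comp (fderiv ℝ f w) :=
      (Complex.ofRealCLM.hasFDerivAt.comp w hw.hasFDerivAt).fderiv
    simp only [delBar, h, single_I]
    simp [he]
  have hd : ∀ v : Model n, HasFDerivAt (fun w => (fderiv ℝ f w v : ℂ))
      (Complex.ofRealCLM.comp (S.flip v)) z := by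
    intro v
    have := (ContDiffAt.differentiableAt_fderiv_of_two hf).hasFDerivAt.clm_apply
      (hasFDerivAt_const v z)
    refine (Complex.ofRealCLM.hasFDerivAt.comp z this).congr_fderiv ?_
    ext w
    simp [hS]
  have h2 := ((hd e).add ((hd (Complex.I • e)).const_mul Complex.I)).const_mul (1 / 2 : ℂ)
  have h3 := (h2.congr_of_eventuallyEq h1).fderiv
  simp only [ddbar, del]
  rw [h3]
  simp only [leviForm, single_I]
  simp
  linear_combination (-(1 / 4 : ℂ) * S (Complex.I • EuclideanSpace.single i (1 : ℂ))
    (Complex.I • e)) * Complex.I_mul_I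

end ChartCalculus

/-! ### Regularity of the metric coefficients and the Chern Laplacian with drift -/

section LocalMetric

variable {n : ℕ}

theorem two_le_infty : (2 : ℕ∞ω) ≤ ∞ :=
  WithTop.coe_le_coe.2 (le_top : (2 : ℕ∞) ≤ ⊤)

theorem ddbar_congr {f f' : Model n → ℝ} {z : Model n} (h : f =ᶠ[𝓝 z] f') (i j : Fin n) :
    ddbar f i j z = ddbar f' i j z := by
  have h1 : (fun w => delBar j (fun v => (f v : ℂ)) w) =ᶠ[𝓝 z]
      fun w => delBar j (fun v => (f' v : ℂ)) w := by
    filter_upwards [h.eventuallyEq_nhds] with w hw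
    have : (fun v => (f v : ℂ)) =ᶠ[𝓝 w] fun v => (f' v : ℂ) := hw.fun_comp Complex.ofReal
    simp only [delBar, this.fderiv_eq]
  simp only [ddbar, del, h1.fderiv_eq]

theorem ddbar_sub {f f' : Model n → ℝ} {z : Model n} (hf : ContDiffAt ℝ 2 f z)
    (hf' : ContDiffAt ℝ 2 f' z) (i j : Fin n) :
    ddbar (fun w => f w - f' w) i j z = ddbar f i j z - ddbar f' i j z := by
  have h1 : fderiv ℝ (fun w => f w - f' w) =ᶠ[𝓝 z] fun y => fderiv ℝ f y - fderiv ℝ f' y := by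
    filter_upwards [ContDiffAt.eventually_differentiableAt_of_two hf,
      ContDiffAt.eventually_differentiableAt_of_two hf'] with y h1 h2
    exact (h1.hasFDerivAt.sub h2.hasFDerivAt).fderiv
  have h2 : fderiv ℝ (fderiv ℝ fun w => f w - f' w) z =
      fderiv ℝ (fderiv ℝ f) z - fderiv ℝ (fderiv ℝ f') z := by
    rw [h1.fderiv_eq]
    exact ((ContDiffAt.differentiableAt_fderiv_of_two hf).hasFDerivAt.sub
      (ContDiffAt.differentiableAt_fderiv_of_two hf').hasFDerivAt).fderiv
  rw [ddbar_eq_leviForm (hf.sub hf'), ddbar_eq_leviForm hf, ddbar_eq_leviForm hf', h2]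
  simp only [leviForm, sub_apply]
  push_cast
  ring

variable {U : Set (Model n)} {G : Model n → Matrix (Fin n) (Fin n) ℂ}

theorem contDiffOn_det_re (hG : ∀ i j, ContDiffOn ℝ ∞ (fun z => G z i j) U) :
    ContDiffOn ℝ ∞ (fun z => (G z).det.re) U := by
  have : ContDiffOn ℝ ∞ (fun z => (G z).det) U := by
    simp only [Matrix.det_apply]
    exact ContDiffOn.sum fun σ _ => (contDiffOn_prod fun i _ => hG _ _).const_smul _
  exact Complex.reCLM.contDiff.comp_contDiffOn this

theorem det_re_pos {M : Matrix (Fin n) (Fin n) ℂ} (hM : M.PosDef) : 0 < M.det.re :=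
  (Complex.pos_iff.1 hM.det_pos).1

theorem contDiffOn_log_det_re (hG : ∀ i j, ContDiffOn ℝ ∞ (fun z => G z i j) U)
    (hpos : ∀ z ∈ U, (G z).PosDef) : ContDiffOn ℝ ∞ (fun z => Real.log (G z).det.re) U :=
  (contDiffOn_det_re hG).log fun z hz => (det_re_pos (hpos z hz)).ne'

theorem continuousOn_invMetric (hG : ∀ i j, ContDiffOn ℝ ∞ (fun z => G z i j) U)
    (hpos : ∀ z ∈ U, (G z).PosDef) (k p : Fin n) : ContinuousOn (invMetric G k p) U := by
  have h1 : ContinuousOn G U :=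
    continuousOn_pi.2 fun i => continuousOn_pi.2 fun j => (hG i j).continuousOn
  intro z hz
  have hdet : (G z).det ≠ 0 := (hpos z hz).det_pos.ne'
  have h2 : ContinuousAt Inv.inv (G z) := continuousAt_matrix_inv _ (by
    rw [Ring.inverse_eq_inv']
    exact continuousAt_inv₀ hdet)
  have h3 : ContinuousWithinAt (fun w => (G w)⁻¹) U z := h2.comp_continuousWithinAt (h1 z hz)
  exact continuousWithinAt_pi.1 (continuousWithinAt_pi.1 h3 p) k

theorem continuousOn_del (hU : IsOpen U) {f : Model n → ℂ} (hf : ContDiffOn ℝ ∞ f U)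
    (i : Fin n) : ContinuousOn (del i f) U := by
  have h := hf.continuousOn_fderiv_of_isOpen hU (by simp)
  exact continuousOn_const.mul ((h.clm_apply continuousOn_const).sub
    (continuousOn_const.mul (h.clm_apply continuousOn_const)))

theorem continuousOn_trTorsion (hU : IsOpen U) (hG : ∀ i j, ContDiffOn ℝ ∞ (fun z => G z i j) U)
    (hpos : ∀ z ∈ U, (G z).PosDef) (j : Fin n) : ContinuousOn (trTorsion G j) U := by
  have hΓ : ∀ k i j, ContinuousOn (christoffel G k i j) U := fun k i j =>
    continuousOn_finsetSum _ fun p _ =>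
      (continuousOn_invMetric hG hpos k p).mul (continuousOn_del hU (hG j p) i)
  exact continuousOn_finsetSum _ fun p _ => (hΓ p p j).sub (hΓ p j p)

/-- The strong maximum principle for the Chern Laplacian with drift. -/
theorem eventually_eq_of_chernLaplacian_eq_zero (hU : IsOpen U)
    (hG : ∀ i j, ContDiffOn ℝ ∞ (fun z => G z i j) U) (hpos : ∀ z ∈ U, (G z).PosDef)
    {a : Fin n → Model n → ℂ} (ha : ∀ j, ContinuousOn (a j) U)
    {f : Model n → ℝ} (hf : ContDiffOn ℝ ∞ f U)
    (hL : ∀ z ∈ U, (∑ i, ∑ j, invMetric G i j z * ddbar f i j z).re +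
      (innerForms G a (fun k => del k fun w => (f w : ℂ)) z).re = 0)
    {p : Model n} (hp : p ∈ U) (hmax : ∀ z ∈ U, f z ≤ f p) : ∀ᶠ z in 𝓝 p, f z = f p := by
  have hinv := continuousOn_invMetric hG hpos
  refine eventually_eq_of_isMaxOn hU (fun z => leviTrace (G z)⁻¹)
    (fun z => covectorPairing (G z)⁻¹ fun j => a j z) ?_ ?_
    (fun z hz S hS => leviTrace_nonpos (hpos z hz).inv.posSemidef hS)
    (fun z hz l hl => leviTrace_smulRight_pos (hpos z hz).inv hl)
    (hf.of_le two_le_infty) ?_ hp hmax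
  · intro S hS
    simp only [leviTrace_apply]
    refine Complex.continuous_re.comp_continuousOn (continuousOn_finsetSum _ fun i _ =>
      continuousOn_finsetSum _ fun j _ => (hinv i j).mul (Continuous.continuousOn ?_))
    unfold leviForm
    fun_prop
  · intro l hl
    simp only [covectorPairing_apply]
    refine Complex.continuous_re.comp_continuousOn (continuousOn_finsetSum _ fun j _ =>
      continuousOn_finsetSum _ fun k _ => ((hinv j k).mul (ha j)).mul (Continuous.continuousOn ?_))
    unfold covectorOneZero
    fun_prop
  · intro z hz
    have hfz : ContDiffAt ℝ 2 f z := (hf.contDiffAt (hU.mem_nhds hz)).of_le two_le_infty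
    refine (hL z hz).symm.le.trans_eq ?_
    simp only [leviTrace_apply, covectorPairing_apply, innerForms, invMetric,
      ddbar_eq_leviForm hfz, del_eq_covectorOneZero (hfz.differentiableAt (by norm_num))]

end LocalMetric

/-! ### From charts to the compact manifold -/

section Manifold

variable {n : ℕ} {X : Type*} [TopologicalSpace X] [ChartedSpace (Model n) X]

theorem isManifold_real [IsManifold 𝓘(ℂ, Model n) ω X] : IsManifold 𝓘(ℝ, Model n) ∞ X := by
  refine isManifold_of_contDiffOn _ _ _ fun e e' he he' => ?_
  have h := (contDiffGroupoid ω 𝓘(ℂ, Model n)).compatible he he'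
  rw [contDiffGroupoid, mem_groupoid_of_pregroupoid] at h
  have h1 : ContDiffOn ℂ ω (e.symm ≫ₕ e') (e.symm ≫ₕ e').source := by
    simpa [contDiffPregroupoid] using h.1
  simpa using (h1.restrict_scalars ℝ).of_le le_top

theorem SmoothFun.contDiffOn [IsManifold 𝓘(ℝ, Model n) ∞ X] {f : X → ℝ} (hf : SmoothFun n f)
    {e : OpenPartialHomeomorph X (Model n)} (he : e ∈ atlas (Model n) X) :
    ContDiffOn ℝ ∞ (fun z => f (e.symm z)) e.target := by
  have h := contMDiffOn_symm_of_mem_maximalAtlas (n := ∞)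
    (IsManifold.subset_maximalAtlas (I := 𝓘(ℝ, Model n)) he)
  exact contMDiffOn_iff_contDiffOn.1 (ContMDiff.comp_contMDiffOn hf h)

theorem smoothFun_of_contDiffOn [IsManifold 𝓘(ℝ, Model n) ∞ X] {f : X → ℝ}
    (hf : ∀ e ∈ atlas (Model n) X, ContDiffOn ℝ ∞ (fun z => f (e.symm z)) e.target) :
    SmoothFun n f := by
  intro x
  have h1 := (contMDiffOn_iff_contDiffOn.2 (hf _ (chart_mem_atlas (Model n) x))).comp
    (contMDiffOn_chart (I := 𝓘(ℝ, Model n)) (n := ∞) (x := x)) fun y hy =>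
      (chartAt (Model n) x).map_source hy
  have h2 : ContMDiffOn 𝓘(ℝ, Model n) 𝓘(ℝ, ℝ) ∞ f (chartAt (Model n) x).source :=
    h1.congr fun y hy => by simp [(chartAt (Model n) x).left_inv hy]
  exact h2.contMDiffAt ((chartAt (Model n) x).open_source.mem_nhds (mem_chart_source _ x))

/-- On a compact manifold the solutions of `Δ f + ⟨a, ∂f⟩ = 0` are locally constant. -/
theorem isLocallyConstant_of_chernLaplacian_eq_zero [CompactSpace X] (g : HermitianMetric n X)
    {f : X → ℝ} (hfc : Continuous f)
    (hf : ∀ e ∈ atlas (Model n) X, ContDiffOn ℝ ∞ (fun z => f (e.symm z)) e.target)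
    (a : OpenPartialHomeomorph X (Model n) → Fin n → Model n → ℂ)
    (ha : ∀ e ∈ atlas (Model n) X, ∀ j, ContinuousOn (a e j) e.target)
    (hL : ∀ e ∈ atlas (Model n) X, ∀ z ∈ e.target,
      (∑ i, ∑ j, invMetric (g.coeff e) i j z * ddbar (fun w => f (e.symm w)) i j z).re +
      (innerForms (g.coeff e) (a e) (fun k => del k fun w => (f (e.symm w) : ℂ)) z).re = 0) :
    IsLocallyConstant f := by
  have : LocallyConnectedSpace X := ChartedSpace.locallyConnectedSpace (Model n) X
  rw [IsLocallyConstant.iff_eventually_eq]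
  intro x
  -- Components are open by local connectedness and compact because closed in X, so the maximum is
  -- attained on each one separately.
  have hCopen : IsOpen (connectedComponent x) := isOpen_connectedComponent
  obtain ⟨p, hp, hpmax⟩ := isClosed_connectedComponent.isCompact.exists_isMaxOn
    ⟨x, mem_connectedComponent (x := x)⟩ hfc.continuousOn
  have hopen : IsOpen (connectedComponent x ∩ {y | f y = f p}) := by
    rw [isOpen_iff_mem_nhds]
    rintro y ⟨hyC, hy : f y = f p⟩
    set e := chartAt (Model n) y with he
    have heA : e ∈ atlas (Model n) X := chart_mem_atlas _ y
    have hye : y ∈ e.source := mem_chart_source _ y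
    -- A chart may meet other components, where `f` could be larger; hence the restriction.
    set U := e.target ∩ e.symm ⁻¹' connectedComponent x with hUdef
    have hU : IsOpen U := e.isOpen_inter_preimage_symm hCopen
    have hUt : U ⊆ e.target := inter_subset_left
    have hloc := eventually_eq_of_chernLaplacian_eq_zero (p := e y) hU
      (fun i j => (g.smooth e heA i j).mono hUt) (fun z hz => g.posDef e heA z (hUt hz))
      (fun j => (ha e heA j).mono hUt) ((hf e heA).mono hUt) (fun z hz => hL e heA z (hUt hz))
      ⟨e.map_source hye, by simpa [e.left_inv hye] using hyC⟩
      (fun z hz => by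
        rw [e.left_inv hye, hy]
        exact hpmax hz.2)
    have h2 := (e.continuousAt hye).eventually hloc
    filter_upwards [h2, e.open_source.mem_nhds hye, hCopen.mem_nhds hyC] with w hw hwe hwC
    rw [e.left_inv hye, e.left_inv hwe, hy] at hw
    exact ⟨hwC, hw⟩
  have hsub : connectedComponent x ⊆ connectedComponent x ∩ {y | f y = f p} := by
    have hclosed : IsClosed (connectedComponent x ∩ {y | f y = f p}) :=
      isClosed_connectedComponent.inter (isClosed_eq hfc continuous_const)
    have := isPreconnected_connectedComponent.subset_isClopen ⟨hclosed, hopen⟩ ⟨p, hp, hp, rfl⟩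
    exact this
  filter_upwards [hCopen.mem_nhds (mem_connectedComponent (x := x))] with y hy
  rw [(hsub hy).2, (hsub (mem_connectedComponent (x := x))).2]

/-! ### Determinant ratios and Chern–Ricci potentials -/

theorem HermitianMetric.det_re_transform (g : HermitianMetric n X)
    {e e' : OpenPartialHomeomorph X (Model n)} (he : e ∈ atlas (Model n) X)
    (he' : e' ∈ atlas (Model n) X) {x : X} (hx : x ∈ e.source ∩ e'.source) :
    (g.coeff e (e x)).det.re =
      Complex.normSq (Matrix.det (jac e e' (e x))) * (g.coeff e' (e' x)).det.re := by
  set J : Matrix (Fin n) (Fin n) ℂ := jac e e' (e x) with hJ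
  have h1 : g.coeff e (e x) = J.transpose * g.coeff e' (e' x) * J.map star := by
    ext i j
    rw [g.transform e he e' he' x hx]
    simp only [Matrix.mul_apply, Matrix.transpose_apply, Matrix.map_apply, Finset.sum_mul]
    rw [Finset.sum_comm]
    exact Finset.sum_congr rfl fun b _ => Finset.sum_congr rfl fun a _ => by rw [hJ]; ring
  have h2 : (J.map star).det = star J.det := by
    rw [← Matrix.det_conjTranspose, Matrix.conjTranspose, ← Matrix.det_transpose]
    rfl
  rw [h1, Matrix.det_mul, Matrix.det_mul, Matrix.det_transpose, h2, mul_right_comm,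
    Complex.star_def, Complex.mul_conj, Complex.re_ofReal_mul]

/-- The global function `log (det g / det g')`. -/
def logDetRatio (g g' : HermitianMetric n X) (x : X) : ℝ :=
  Real.log ((g.coeff (chartAt (Model n) x) (chartAt (Model n) x x)).det.re /
    (g'.coeff (chartAt (Model n) x) (chartAt (Model n) x x)).det.re)

theorem logDetRatio_symm_apply (g g' : HermitianMetric n X)
    {e : OpenPartialHomeomorph X (Model n)} (he : e ∈ atlas (Model n) X) {z : Model n}
    (hz : z ∈ e.target) : logDetRatio g g' (e.symm z) =
      Real.log ((g.coeff e z).det.re / (g'.coeff e z).det.re) := by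
  set x := e.symm z with hx
  have hxe : x ∈ e.source := e.map_target hz
  have hez : e x = z := e.right_inv hz
  have hxc := mem_chart_source (Model n) x
  have hc := chart_mem_atlas (Model n) x
  have h1 := g.det_re_transform he hc ⟨hxe, hxc⟩
  have h2 := g'.det_re_transform he hc ⟨hxe, hxc⟩
  rw [hez] at h1 h2
  have h3 := det_re_pos (g.posDef e he z hz)
  -- The Jacobian is nonsingular because the determinant on the left of `h1` is positive.
  have hJ : Complex.normSq (Matrix.det (jac e (chartAt (Model n) x) z)) ≠ 0 := by
    intro h
    rw [h, zero_mul] at h1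
    exact h3.ne' h1
  rw [h1, h2, mul_div_mul_left _ _ hJ, logDetRatio]

theorem logDetRatio_symm_eqOn (g g' : HermitianMetric n X)
    {e : OpenPartialHomeomorph X (Model n)} (he : e ∈ atlas (Model n) X) :
    EqOn (fun z => logDetRatio g g' (e.symm z))
      (fun z => Real.log (g.coeff e z).det.re - Real.log (g'.coeff e z).det.re) e.target := by
  intro z hz
  simp only [logDetRatio_symm_apply g g' he hz]
  exact Real.log_div (det_re_pos (g.posDef e he z hz)).ne' (det_re_pos (g'.posDef e he z hz)).ne'

theorem smoothFun_logDetRatio [IsManifold 𝓘(ℝ, Model n) ∞ X] (g g' : HermitianMetric n X) :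
    SmoothFun n (logDetRatio g g') :=
  smoothFun_of_contDiffOn fun e he =>
    ((contDiffOn_log_det_re (g.smooth e he) (g.posDef e he)).sub
      (contDiffOn_log_det_re (g'.smooth e he) (g'.posDef e he))).congr
      (logDetRatio_symm_eqOn g g' he)

theorem ddbar_logDetRatio (g g' : HermitianMetric n X)
    {e : OpenPartialHomeomorph X (Model n)} (he : e ∈ atlas (Model n) X) {z : Model n}
    (hz : z ∈ e.target) (i j : Fin n) :
    ddbar (fun w => logDetRatio g g' (e.symm w)) i j z =
      chernRicci (g'.coeff e) i j z - chernRicci (g.coeff e) i j z := by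
  have hnhds := e.open_target.mem_nhds hz
  have hlog : ∀ h : HermitianMetric n X,
      ContDiffAt ℝ 2 (fun w => Real.log (h.coeff e w).det.re) z := fun h =>
    ((contDiffOn_log_det_re (h.smooth e he) (h.posDef e he)).contDiffAt hnhds).of_le two_le_infty
  rw [ddbar_congr ((logDetRatio_symm_eqOn g g' he).eventuallyEq_of_mem hnhds),
    ddbar_sub (hlog g) (hlog g')]
  simp only [chernRicci]
  ring

/-- Chern–Ricci forms of two metrics differ by ∂∂̄ of the log determinant ratio, so a potential for
one metric yields a potential for any other. -/
theorem HermitianMetric.IsChernRicciPotential.sub_logDetRatio [IsManifold 𝓘(ℝ, Model n) ∞ X]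
    {g : HermitianMetric n X} {F : X → ℝ} (hF : g.IsChernRicciPotential F)
    (g' : HermitianMetric n X) :
    g'.IsChernRicciPotential fun x => F x - logDetRatio g' g x := by
  have hR := smoothFun_logDetRatio g' g
  refine ⟨ContMDiff.sub hF.1 hR, fun e he z hz i j => ?_⟩
  have hnhds := e.open_target.mem_nhds hz
  rw [ddbar_sub (((hF.1.contDiffOn he).contDiffAt hnhds).of_le two_le_infty)
    (((hR.contDiffOn he).contDiffAt hnhds).of_le two_le_infty), ddbar_logDetRatio g' g he hz,
    hF.2 e he z hz]
  ring

/-- The function `log (det g / det g₀) - F`. -/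
def relativePotential (g₀ g : HermitianMetric n X) (F : X → ℝ) (x : X) : ℝ :=
  logDetRatio g g₀ x - F x

/-! ### Fixed points and Chern–Ricci flatness -/

theorem isFixedPoint_iff_flowRHS_eq_zero {g₀ g : HermitianMetric n X} {F φ : X → ℝ}
    (hφ : g₀.IsDeformation φ g) :
    g₀.IsFixedPoint F φ g ↔ ∀ e ∈ atlas (Model n) X, ∀ z ∈ e.target,
      flowRHS (g₀.coeff e) (fun w => F (e.symm w)) (g.coeff e) z = 0 := by
  constructor
  · intro h e he z hz
    have h1 := (h 0 self_mem_Ici).2 e he z hz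
    -- At time 0 the derivative is one-sided, but still unique on the half-line.
    exact (uniqueDiffOn_Ici (0 : ℝ) 0 self_mem_Ici).eq_deriv _ h1 (hasDerivWithinAt_const _ _ _)
  · intro h t _
    refine ⟨hφ, fun e he z hz => ?_⟩
    rw [h e he z hz]
    exact hasDerivWithinAt_const _ _ _

variable [IsManifold 𝓘(ℝ, Model n) ∞ X] {g₀ g : HermitianMetric n X} {F : X → ℝ}

theorem smoothFun_relativePotential (hF : SmoothFun n F) :
    SmoothFun n (relativePotential g₀ g F) :=
  ContMDiff.sub (smoothFun_logDetRatio g g₀) hF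

theorem chernRicci_eq_neg_ddbar_relativePotential (hF : g₀.IsChernRicciPotential F)
    {e : OpenPartialHomeomorph X (Model n)} (he : e ∈ atlas (Model n) X) {z : Model n}
    (hz : z ∈ e.target) (i j : Fin n) : chernRicci (g.coeff e) i j z =
      -ddbar (fun w => relativePotential g₀ g F (e.symm w)) i j z := by
  have hnhds := e.open_target.mem_nhds hz
  simp only [relativePotential]
  rw [ddbar_sub ((((smoothFun_logDetRatio g g₀).contDiffOn he).contDiffAt hnhds).of_le two_le_infty)
    (((hF.1.contDiffOn he).contDiffAt hnhds).of_le two_le_infty), ddbar_logDetRatio g g₀ he hz,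
    hF.2 e he z hz]
  ring

theorem flowRHS_eq (hF : g₀.IsChernRicciPotential F)
    {e : OpenPartialHomeomorph X (Model n)} (he : e ∈ atlas (Model n) X) {z : Model n}
    (hz : z ∈ e.target) : flowRHS (g₀.coeff e) (fun w => F (e.symm w)) (g.coeff e) z =
      -(∑ i, ∑ j, invMetric (g.coeff e) i j z *
        ddbar (fun w => relativePotential g₀ g F (e.symm w)) i j z).re +
      2 * (innerForms (g.coeff e) (trTorsion (g.coeff e))
        (fun k => del k fun w => (relativePotential g₀ g F (e.symm w) : ℂ)) z).re := by
  have h1 : (fun w => ((Real.log ((g.coeff e w).det.re / (g₀.coeff e w).det.re)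
      - F (e.symm w) : ℝ) : ℂ)) =ᶠ[𝓝 z]
      fun w => (relativePotential g₀ g F (e.symm w) : ℂ) := by
    filter_upwards [e.open_target.mem_nhds hz] with w hw
    rw [relativePotential, logDetRatio_symm_apply g g₀ he hw]
  simp only [flowRHS, chernScalar, innerForms, del, h1.fderiv_eq,
    chernRicci_eq_neg_ddbar_relativePotential hF he hz, mul_neg, Finset.sum_neg_distrib,
    Complex.neg_re]

theorem flowRHS_eq_zero_iff_chernRicciFlat [CompactSpace X] (hF : g₀.IsChernRicciPotential F) :
    (∀ e ∈ atlas (Model n) X, ∀ z ∈ e.target,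
      flowRHS (g₀.coeff e) (fun w => F (e.symm w)) (g.coeff e) z = 0) ↔ g.ChernRicciFlat := by
  have hsm := smoothFun_relativePotential (g₀ := g₀) (g := g) hF.1
  have hloc : IsLocallyConstant (relativePotential g₀ g F) →
      ∀ e ∈ atlas (Model n) X, ∀ z ∈ e.target, ∀ᶠ w in 𝓝 z,
        relativePotential g₀ g F (e.symm w) = relativePotential g₀ g F (e.symm z) :=
    fun h e he z hz => (e.symm.continuousAt hz).eventually
      ((IsLocallyConstant.iff_eventually_eq _).1 h (e.symm z))
  constructor
  · intro h
    have hlc : IsLocallyConstant (relativePotential g₀ g F) := by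
      -- The drift -2 tr T comes from changing the sign of -Δu + 2 Re⟨tr T, ∂u⟩.
      refine isLocallyConstant_of_chernLaplacian_eq_zero g hsm.continuous
        (fun e he => hsm.contDiffOn he) (fun e j z => (-2 : ℂ) * trTorsion (g.coeff e) j z)
        (fun e he j => continuousOn_const.mul (continuousOn_trTorsion e.open_target
          (g.smooth e he) (g.posDef e he) j)) fun e he z hz => ?_
      have h1 := h e he z hz
      rw [flowRHS_eq hF he hz] at h1
      have h2 : ∀ b : Fin n → Model n → ℂ, innerForms (g.coeff e)
          (fun j z => (-2 : ℂ) * trTorsion (g.coeff e) j z) b z =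
          ((-2 : ℝ) : ℂ) * innerForms (g.coeff e) (trTorsion (g.coeff e)) b z := by
        intro b
        simp only [innerForms, Finset.mul_sum]
        refine Finset.sum_congr rfl fun j _ => Finset.sum_congr rfl fun k _ => ?_
        push_cast
        ring
      rw [h2, Complex.re_ofReal_mul]
      linarith
    intro e he z hz i j
    rw [chernRicci_eq_neg_ddbar_relativePotential hF he hz, ddbar_congr (hloc hlc e he z hz)]
    simp [ddbar, del, delBar]
  · intro h
    have hdd : ∀ e ∈ atlas (Model n) X, ∀ z ∈ e.target, ∀ i j,
        ddbar (fun w => relativePotential g₀ g F (e.symm w)) i j z = 0 := by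
      intro e he z hz i j
      have := chernRicci_eq_neg_ddbar_relativePotential (g := g) hF he hz i j
      rw [h e he z hz i j] at this
      exact neg_eq_zero.1 this.symm
    -- Flatness kills Δu but leaves the gradient term; the principle with zero drift removes it.
    have hlc : IsLocallyConstant (relativePotential g₀ g F) := by
      refine isLocallyConstant_of_chernLaplacian_eq_zero g hsm.continuous
        (fun e he => hsm.contDiffOn he) (fun _ _ _ => 0) (fun _ _ _ => continuousOn_const)
        fun e he z hz => ?_
      simp [hdd e he z hz, innerForms]
    intro e he z hz
    have h1 : (fun w => (relativePotential g₀ g F (e.symm w) : ℂ)) =ᶠ[𝓝 z]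
        fun _ => (relativePotential g₀ g F (e.symm z) : ℂ) :=
      (hloc hlc e he z hz).mono fun w hw => congrArg Complex.ofReal hw
    rw [flowRHS_eq hF he hz]
    simp [hdd e he z hz, innerForms, del, h1.fderiv_eq]

end Manifold

end ChernCalabi

end

theorem mainTheorem3 (n : ℕ) (X : Type*) [TopologicalSpace X] [T2Space X] [CompactSpace X]
    [ChartedSpace (ChernCalabi.Model n) X]
    [IsManifold 𝓘(ℂ, ChernCalabi.Model n) ω X]
    (hc₁ : ChernCalabi.FirstBottChernClassEqZero n X)
    (g₀ : ChernCalabi.HermitianMetric n X)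
    (hdd : ∀ k ∈ ({1, 2} : Set ℕ), g₀.DDbarPowEqZero k) :
    (∃ F : X → ℝ, g₀.IsChernRicciPotential F) ∧
    ∀ F : X → ℝ, g₀.IsChernRicciPotential F →
      ∀ (φ : X → ℝ) (g : ChernCalabi.HermitianMetric n X), g₀.IsDeformation φ g →
        (g₀.IsFixedPoint F φ g ↔ g.ChernRicciFlat) := by
  have : IsManifold 𝓘(ℝ, ChernCalabi.Model n) ∞ X := ChernCalabi.isManifold_real
  obtain ⟨g₁, F₁, hF₁⟩ := hc₁
  refine ⟨⟨_, hF₁.sub_logDetRatio g₀⟩, fun F hF φ g hφ => ?_⟩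
  rw [ChernCalabi.isFixedPoint_iff_flowRHS_eq_zero hφ,
    ChernCalabi.flowRHS_eq_zero_iff_chernRicciFlat hF]
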